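/- Let $\pi$ be a virtually polycyclic group, that is, a group with a finite-index subgroup $K$ that admits a subnormal series $1=K_0\trianglelefteq K_1\trianglelefteq\cdots\trianglelefteq K_n=K$ with all quotients $K_{j+1}/K_j$ cyclic. For a homomorphism $\rho\colon\pi\to\mathbb{C}^\times$, let $\mathbb{C}_\rho$ be the right $\pi$-module with underlying vector space $\mathbb{C}$ and action $z\cdot g=z\,\rho(g)$. For integers $i,r\ge 0$, let $$\mathcal{V}^i_r(\pi)=\{\rho\in\operatorname{Hom}(\pi,\mathbb{C}^\times)\mid \dim_{\mathbb{C}}H_i(\pi,\mathbb{C}_\rho)\ge r\}.$$ Then, for every $i\ge 0$, the characteristic variety $\mathcal{V}^i_1(\pi)$ is a finite set. -/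

import Mathlib

/-- A group is polycyclic if it has a finite subnormal series
`1 = H 0 ≤ H 1 ≤ ⋯ ≤ H n = G` all of whose factors are cyclic (finite or infinite). -/
def IsPolycyclicGroup (G : Type*) [Group G] : Prop :=
  ∃ (n : ℕ) (H : ℕ → Subgroup G), H 0 = ⊥ ∧ H n = ⊤ ∧
    ∀ k < n, H k ≤ H (k + 1) ∧
      ∃ _ : ((H k).subgroupOf (H (k + 1))).Normal,
        IsCyclic (H (k + 1) ⧸ (H k).subgroupOf (H (k + 1)))

/-- A group is virtually polycyclic if it has a polycyclic subgroup of finite index. -/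
def IsVirtuallyPolycyclicGroup (G : Type*) [Group G] : Prop :=
  ∃ K : Subgroup G, K.FiniteIndex ∧ IsPolycyclicGroup K

/-- For a character `ρ : G → ℂˣ`, the left action of `G` on `ℂ` by `g • z = ρ(g)⁻¹ z`.

Group homology with coefficients in a left `ℂ[G]`-module is formed in Mathlib from the associated
right module `z · g = g⁻¹ • z`, which here is `z · g = z ρ(g)`: the right module `ℂ_ρ`. -/
noncomputable def characterRepresentation {G : Type*} [Group G] (ρ : G →* ℂˣ) :
    Representation ℂ G ℂ where
  toFun g := LinearMap.mulLeft ℂ ((ρ g)⁻¹ : ℂˣ)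
  map_one' := by
    ext
    simp
  map_mul' g h := by
    ext
    simp [mul_comm]

/-- The homology `H_i(G, ℂ_ρ)` of `G` with coefficients in the rank one right module `ℂ_ρ`,
where `z · g = z ρ(g)`. -/
noncomputable abbrev characterHomology {G : Type} [Group G] (ρ : G →* ℂˣ) (i : ℕ) :
    ModuleCat ℂ :=
  groupHomology (Rep.of (characterRepresentation ρ)) i

/-- The characteristic variety `𝒱ⁱ_r(G)` in degree `i` and depth `r`: the set of characters
`ρ : G → ℂˣ` with `dim H_i(G, ℂ_ρ) ≥ r`.  The dimension is a cardinal, so that an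
infinite-dimensional homology group counts as having dimension at least `r`. -/
def characteristicVariety (G : Type) [Group G] (i r : ℕ) : Set (G →* ℂˣ) :=
  {ρ | (r : Cardinal) ≤ Module.rank ℂ (characterHomology ρ i)}

open CategoryTheory Representation
open scoped LaurentPolynomial

/-! Induction along the polycyclic series, with finite-dimensionality of the homology added to the
claim (`HasTameCharacterHomology`). For an infinite cyclic quotient, let `p : G → ℤ` be onto with
kernel `N`. By Shapiro, the Laurent module twisted by `ρ` has homology `H_i(N, ρ|N)`, on which `T`
acts by an endomorphism `τ`. The quotient of this module by `1 - c T` is the character `ρ · c ^ p`,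
so its homology in degree `i` vanishes once `1 - c τ` is bijective in degrees `i` and `i - 1`.
Finite dimension leaves finitely many bad `c`, and `ρ|N` itself must lie in a finite set (`of_ker`).
For a subgroup of finite index, transfer makes homology of the subgroup surject onto that of the
group, and restriction of characters has finite fibres (`of_finiteIndex`). This handles finite
cyclic quotients and the passage from polycyclic to virtually polycyclic. -/

lemma LaurentPolynomial.one_sub_smul_T_dvd_of_eval₂_eq_zero {k : Type*} [Field k] (c : kˣ)
    {f : k[T;T⁻¹]} (hf : LaurentPolynomial.eval₂ (RingHom.id k) c⁻¹ f = 0) :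
    (1 - (c : k) • LaurentPolynomial.T 1 : k[T;T⁻¹]) ∣ f := by
  let u : k[T;T⁻¹]ˣ :=
    { val := (c : k) • T 1
      inv := ((c⁻¹ : kˣ) : k) • T (-1)
      val_inv := by rw [smul_mul_smul_comm, ← T_add]; simp
      inv_val := by rw [smul_mul_smul_comm, ← T_add]; simp }
  have hu (n : ℤ) : (1 - (u : k[T;T⁻¹])) ∣ 1 - ((u ^ n : k[T;T⁻¹]ˣ) : k[T;T⁻¹]) := by
    have hnat (n : ℕ) : (1 - (u : k[T;T⁻¹])) ∣ 1 - ((u ^ n : k[T;T⁻¹]ˣ) : k[T;T⁻¹]) := by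
      simpa using sub_dvd_pow_sub_pow (1 : k[T;T⁻¹]) u n
    obtain ⟨m, rfl | rfl⟩ := n.eq_nat_or_neg
    · simpa using hnat m
    · have h : (1 - ((u ^ (-(m : ℤ)) : k[T;T⁻¹]ˣ) : k[T;T⁻¹])) =
          -((u ^ (-(m : ℤ)) : k[T;T⁻¹]ˣ) : k[T;T⁻¹]) * (1 - ((u ^ m : k[T;T⁻¹]ˣ) : k[T;T⁻¹])) := by
        have : ((u ^ (-(m : ℤ)) : k[T;T⁻¹]ˣ) : k[T;T⁻¹]) * ((u ^ m : k[T;T⁻¹]ˣ) : k[T;T⁻¹]) = 1 := by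
          rw [← Units.val_mul]; simp
        linear_combination -this
      rw [h]
      exact (hnat m).mul_left _
  have hT (n : ℤ) : ((u ^ n : k[T;T⁻¹]ˣ) : k[T;T⁻¹]) = ((c ^ n : kˣ) : k) • T n := by
    have key : ∀ n : ℕ, ((u ^ n : k[T;T⁻¹]ˣ) : k[T;T⁻¹]) = ((c ^ n : kˣ) : k) • T n := by
      intro n
      simp [u, smul_pow, T_pow]
    obtain ⟨m, rfl | rfl⟩ := n.eq_nat_or_neg
    · simpa using key m
    · rw [zpow_neg, zpow_natCast, Units.inv_eq_of_mul_eq_one_right]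
      rw [key, smul_mul_smul_comm, ← T_add]
      simp
  -- Modulo `1 - c T`, the variable `T` equals `c⁻¹`, so every `g` is congruent to its value there.
  have hdvd : ∀ g : k[T;T⁻¹], (1 - (u : k[T;T⁻¹])) ∣
      g - C (LaurentPolynomial.eval₂ (RingHom.id k) c⁻¹ g) := by
    intro g
    induction g using LaurentPolynomial.induction_on' with
    | add p q hp hq =>
      rw [map_add, map_add, add_sub_add_comm]
      exact dvd_add hp hq
    | C_mul_T n a =>
      rw [eval₂_C_mul_T]
      have : C a * T n - C ((RingHom.id k) a * ((c⁻¹ ^ n : kˣ) : k)) =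
          -(C (a * ((c⁻¹ ^ n : kˣ) : k)) * (1 - ((u ^ n : k[T;T⁻¹]ˣ) : k[T;T⁻¹]))) := by
        rw [hT, smul_eq_C_mul, mul_sub, ← mul_assoc, ← map_mul]
        have : a * ((c⁻¹ ^ n : kˣ) : k) * ((c ^ n : kˣ) : k) = a := by
          rw [mul_assoc, ← Units.val_mul]; simp
        rw [this]
        simp
      rw [this]
      exact ((hu n).mul_left _).neg_right
  simpa [hf] using hdvd f

/-- A nonzero kernel vector of `1 - c f` is an eigenvector of `f` with eigenvalue `c⁻¹`. -/
lemma Module.End.finite_setOf_not_bijective_one_sub_smul {k V : Type*} [Field k] [AddCommGroup V]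
    [Module k V] [Module.Finite k V] (f : Module.End k V) :
    {c : kˣ | ¬ Function.Bijective (1 - (c : k) • f : Module.End k V)}.Finite := by
  refine ((f.finite_hasEigenvalue).preimage
    (f := fun c : kˣ ↦ ((c⁻¹ : kˣ) : k)) (fun a _ b _ h ↦ inv_injective (Units.ext h))).subset ?_
  intro c hc
  by_contra h
  apply hc
  have hinj : Function.Injective (1 - (c : k) • f : Module.End k V) := by
    rw [injective_iff_map_eq_zero]
    intro v hv
    by_contra hv0
    refine h (Module.End.hasEigenvalue_of_hasEigenvector (x := v) ⟨?_, hv0⟩)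
    rw [Module.End.mem_eigenspace_iff]
    have hv' : v = (c : k) • f v := by simpa [sub_eq_zero] using hv
    conv_rhs => rw [hv']
    rw [smul_smul, ← Units.val_mul]
    simp
  exact ⟨hinj, LinearMap.injective_iff_surjective.1 hinj⟩

namespace groupHomology

variable {k G : Type} [CommRing k] [Group G]

lemma chainsMap_one_sub_smul {A : Rep k G} (c : k) (φ : A ⟶ A) :
    chainsMap (MonoidHom.id G) (𝟙 A - c • φ : A ⟶ A) =
      𝟙 _ - c • chainsMap (MonoidHom.id G) φ := by
  ext n x a y
  simp [chainsMap_f, Rep.sub_hom, Rep.smul_hom]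

lemma map_one_sub_smul {A : Rep k G} (c : k) (φ : A ⟶ A) (n : ℕ) :
    (map (MonoidHom.id G) (𝟙 A - c • φ : A ⟶ A) n).hom =
      1 - c • (map (MonoidHom.id G) φ n).hom := by
  have hsmul : HomologicalComplex.homologyMap (c • chainsMap (MonoidHom.id G) φ) n =
      c • map (MonoidHom.id G) φ n :=
    ShortComplex.homologyMap_smul
      ((HomologicalComplex.shortComplexFunctor _ _ n).map (chainsMap (MonoidHom.id G) φ)) c
  rw [map, chainsMap_one_sub_smul, HomologicalComplex.homologyMap_sub, hsmul,
    HomologicalComplex.homologyMap_id]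
  rfl

end groupHomology

/-! ### The Laurent module and its quotients by `1 - c T` -/

section LaurentRepresentation

variable {G : Type} [Group G] (p : G →* Multiplicative ℤ) (ρ : G →* ℂˣ)

/-- The Laurent polynomials `ℂ[T;T⁻¹]` with the action `g • f = ρ(g)⁻¹ T ^ p(g) f`. -/
noncomputable def laurentRepresentation : Representation ℂ G ℂ[T;T⁻¹] where
  toFun g := (((ρ g)⁻¹ : ℂˣ) : ℂ) • LinearMap.mulLeft ℂ (LaurentPolynomial.T (p g).toAdd)
  map_one' := by
    ext
    simp
  map_mul' g h := by
    refine LinearMap.ext fun f ↦ ?_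
    simp only [map_mul, mul_inv_rev, Units.val_mul, toAdd_mul, LaurentPolynomial.T_add,
      LinearMap.smul_apply, LinearMap.mulLeft_apply, Module.End.mul_apply, mul_smul_comm,
      smul_smul, mul_assoc]

lemma laurentRepresentation_apply (g : G) (f : ℂ[T;T⁻¹]) :
    laurentRepresentation p ρ g f =
      (((ρ g)⁻¹ : ℂˣ) : ℂ) • (LaurentPolynomial.T (p g).toAdd * f) := rfl

lemma characterRepresentation_apply (g : G) (z : ℂ) :
    characterRepresentation ρ g z = (((ρ g)⁻¹ : ℂˣ) : ℂ) * z := rfl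

/-- Multiplication by `T` as an endomorphism of the Laurent representation. -/
noncomputable def laurentShift :
    Rep.of (laurentRepresentation p ρ) ⟶ Rep.of (laurentRepresentation p ρ) :=
  Rep.ofHom ⟨LinearMap.mulLeft ℂ (LaurentPolynomial.T 1), fun g ↦ LinearMap.ext fun f ↦ by
    simp only [LinearMap.comp_apply, LinearMap.mulLeft_apply, laurentRepresentation_apply,
      mul_smul_comm, mul_left_comm]⟩

lemma one_sub_smul_laurentShift_hom_apply (c : ℂ) (f : ℂ[T;T⁻¹]) :
    (𝟙 _ - c • laurentShift p ρ).hom f = (1 - c • LaurentPolynomial.T 1) * f := by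
  rw [sub_mul, one_mul, smul_mul_assoc]
  rfl

/-- The product of `ρ` with the character `g ↦ c ^ p(g)`. -/
noncomputable def twistCharacter (c : ℂˣ) : G →* ℂˣ :=
  ρ * (zpowersHom ℂˣ c).comp p

lemma twistCharacter_apply (c : ℂˣ) (g : G) :
    twistCharacter p ρ c g = ρ g * c ^ (p g).toAdd := by
  simp [twistCharacter, zpowersHom_apply]

/-- Evaluation at `c⁻¹`, from the Laurent representation to the twist of `ρ` by `c`. -/
noncomputable def laurentEval (c : ℂˣ) :
    Rep.of (laurentRepresentation p ρ) ⟶ Rep.of (characterRepresentation (twistCharacter p ρ c)) :=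
  Rep.ofHom
    ⟨{ LaurentPolynomial.eval₂ (RingHom.id ℂ) c⁻¹ with
        map_smul' := fun a f ↦ by
          simp [LaurentPolynomial.smul_eq_C_mul] }, fun g ↦ LinearMap.ext fun f ↦ by
    -- Characters act through inverses, so `T ^ p(g)` has to become `c ^ (-p(g))`: hence evaluation
    -- at `c⁻¹`.
    simp [laurentRepresentation_apply, characterRepresentation_apply, twistCharacter_apply,
      LaurentPolynomial.smul_eq_C_mul]
    ring⟩

lemma laurentEval_hom_apply (c : ℂˣ) (f : ℂ[T;T⁻¹]) :
    (laurentEval p ρ c).hom f = LaurentPolynomial.eval₂ (RingHom.id ℂ) c⁻¹ f := rfl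

lemma laurentShift_comp_laurentEval (c : ℂˣ) :
    (𝟙 _ - (c : ℂ) • laurentShift p ρ) ≫ laurentEval p ρ c = 0 := by
  refine Rep.hom_ext (IntertwiningMap.ext (LinearMap.ext fun (f : ℂ[T;T⁻¹]) ↦ ?_))
  have h : LaurentPolynomial.eval₂ (RingHom.id ℂ) c⁻¹
      ((1 - (c : ℂ) • LaurentPolynomial.T 1) * f) = 0 := by
    rw [map_mul]
    simp [LaurentPolynomial.smul_eq_C_mul]
  rw [← one_sub_smul_laurentShift_hom_apply p ρ] at h
  exact h

/-- The sequence `ℂ[T;T⁻¹] ⟶ ℂ[T;T⁻¹] ⟶ ℂ` given by multiplication by `1 - c T` and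
evaluation at `c⁻¹`. -/
noncomputable def laurentShortComplex (c : ℂˣ) : ShortComplex (Rep ℂ G) where
  f := 𝟙 _ - (c : ℂ) • laurentShift p ρ
  g := laurentEval p ρ c
  zero := laurentShift_comp_laurentEval p ρ c

lemma laurentShortComplex_shortExact (c : ℂˣ) : (laurentShortComplex p ρ c).ShortExact where
  exact := by
    rw [← ShortComplex.exact_map_iff_of_faithful (laurentShortComplex p ρ c)
      (forget₂ (Rep ℂ G) (ModuleCat ℂ)), ShortComplex.moduleCat_exact_iff]
    intro f hf
    obtain ⟨q, hq⟩ := LaurentPolynomial.one_sub_smul_T_dvd_of_eval₂_eq_zero c hf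
    exact ⟨q, (one_sub_smul_laurentShift_hom_apply p ρ c q).trans hq.symm⟩
  mono_f := by
    rw [Rep.mono_iff_injective]
    intro (f : ℂ[T;T⁻¹]) (g : ℂ[T;T⁻¹]) hfg
    replace hfg : (1 - (c : ℂ) • LaurentPolynomial.T 1) * f =
        (1 - (c : ℂ) • LaurentPolynomial.T 1) * g := by
      rw [← one_sub_smul_laurentShift_hom_apply p ρ, ← one_sub_smul_laurentShift_hom_apply p ρ]
      exact hfg
    have hne : (1 - (c : ℂ) • LaurentPolynomial.T 1 : ℂ[T;T⁻¹]) ≠ 0 := fun h ↦ by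
      have := congr(($h).coeff 0)
      simp [← LaurentPolynomial.T_zero] at this
    exact mul_left_cancel₀ (M₀ := ℂ[T;T⁻¹]) hne hfg
  epi_g := by
    rw [Rep.epi_iff_surjective]
    intro z
    exact ⟨LaurentPolynomial.C z, (laurentEval_hom_apply p ρ c _).trans (LaurentPolynomial.eval₂_C ..)⟩

end LaurentRepresentation

/-! ### The Laurent module as a representation induced from `ker p` -/

section LaurentInduced

variable {G : Type} [Group G] (p : G →* Multiplicative ℤ) (ρ : G →* ℂˣ)

/-- The map from the representation induced from `ker p` to the Laurent representation which is
adjoint to the inclusion of the constants. -/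
noncomputable def indToLaurent :
    Rep.ind p.ker.subtype (Rep.of (characterRepresentation (ρ.comp p.ker.subtype))) ⟶
      Rep.of (laurentRepresentation p ρ) :=
  (Rep.indResHomEquiv p.ker.subtype _ _).symm
    (Rep.ofHom ⟨Algebra.linearMap ℂ ℂ[T;T⁻¹], fun g ↦ LinearMap.ext fun z ↦ by
      have hg : p g = 1 := g.2
      simp [characterRepresentation_apply, laurentRepresentation_apply, hg, Algebra.smul_def]⟩)

lemma indToLaurent_hom_mk_one (z : ℂ) :
    (indToLaurent p ρ).hom (IndV.mk _ _ 1 z) = algebraMap ℂ ℂ[T;T⁻¹] z :=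
  congr(($((Rep.indResHomEquiv p.ker.subtype _ (Rep.of (laurentRepresentation p ρ))).apply_symm_apply
    (Rep.ofHom ⟨Algebra.linearMap ℂ ℂ[T;T⁻¹], _⟩))).hom z)

/-- The generator at `h` is the translate by `h⁻¹` of the generator at `1`, which explains the sign
of the exponent. -/
lemma indToLaurent_hom_mk (h : G) (z : ℂ) :
    (indToLaurent p ρ).hom (IndV.mk _ _ h z) =
      (ρ h * z) • LaurentPolynomial.T (-(p h).toAdd) := by
  have h1 := ind_mk p.ker.subtype (characterRepresentation (ρ.comp p.ker.subtype)) h⁻¹ 1 z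
  rw [one_mul, inv_inv] at h1
  rw [← h1]
  refine (Rep.hom_comm_apply (indToLaurent p ρ) h⁻¹ _).trans ?_
  rw [indToLaurent_hom_mk_one]
  refine (laurentRepresentation_apply ..).trans ?_
  simp [Algebra.algebraMap_eq_smul_one, smul_smul]

/-- The inverse of `indToLaurent`, depending on a lift `t` of the generator of `ℤ`. -/
noncomputable def laurentToInd (t : G) :
    ℂ[T;T⁻¹] →ₗ[ℂ] IndV p.ker.subtype (characterRepresentation (ρ.comp p.ker.subtype)) :=
  Finsupp.lift _ ℂ ℤ (fun n ↦ IndV.mk _ _ (t ^ (-n)) (((ρ t) ^ n : ℂˣ) : ℂ)) ∘ₗ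
    (AddMonoidAlgebra.coeffLinearEquiv ℂ).toLinearMap

lemma laurentToInd_T (t : G) (n : ℤ) :
    laurentToInd p ρ t (LaurentPolynomial.T n) =
      IndV.mk _ _ (t ^ (-n)) (((ρ t) ^ n : ℂˣ) : ℂ) := by
  rw [laurentToInd, LaurentPolynomial.T]
  simp [-LaurentPolynomial.single_eq_C_mul_T]

lemma indV_mk_mul (g : p.ker) (h : G) (z : ℂ) :
    IndV.mk p.ker.subtype (characterRepresentation (ρ.comp p.ker.subtype)) (g * h) z =
      IndV.mk _ _ h (ρ g * z) := by
  have h1 := Coinvariants.mk_tmul_inv (ρ := (leftRegular ℂ G).comp p.ker.subtype)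
    (τ := characterRepresentation (ρ.comp p.ker.subtype)) (.single h 1) z g
  rw [characterRepresentation_apply] at h1
  simpa using h1.symm

lemma indToLaurent_bijective (hp : Function.Surjective p) :
    Function.Bijective (indToLaurent p ρ).hom := by
  obtain ⟨t, ht⟩ := hp (Multiplicative.ofAdd 1)
  have hpt (n : ℤ) : (p (t ^ n)).toAdd = n := by simp [ht]
  have h1 : laurentToInd p ρ t ∘ₗ (indToLaurent p ρ).hom.toLinearMap = LinearMap.id := by
    refine IndV.hom_ext _ _ fun h ↦ LinearMap.ext fun z ↦ ?_
    change laurentToInd p ρ t ((indToLaurent p ρ).hom (IndV.mk _ _ h z)) = IndV.mk _ _ h z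
    rw [indToLaurent_hom_mk, map_smul, laurentToInd_T, neg_neg, ← map_smul]
    set m := (p h).toAdd with hm
    have hk : h * t ^ (-m) ∈ p.ker := by
      rw [MonoidHom.mem_ker]
      apply Multiplicative.toAdd.injective
      rw [map_mul, toAdd_mul, hpt]
      simp [hm]
    conv_rhs => rw [show h = (⟨_, hk⟩ : p.ker) * t ^ m by simp]
    rw [indV_mk_mul]
    congr 1
    simp
    ring
  have h2 : (indToLaurent p ρ).hom.toLinearMap ∘ₗ laurentToInd p ρ t = LinearMap.id := by
    refine AddMonoidAlgebra.lhom_ext' fun n ↦ LinearMap.ext_ring ?_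
    change (indToLaurent p ρ).hom (laurentToInd p ρ t (LaurentPolynomial.T n)) =
      LaurentPolynomial.T n
    rw [laurentToInd_T, indToLaurent_hom_mk, hpt, neg_neg, ← Units.val_mul, ← map_zpow,
      ← map_mul]
    simp
  exact ⟨Function.LeftInverse.injective (g := laurentToInd p ρ t) (LinearMap.congr_fun h1),
    Function.RightInverse.surjective (g := laurentToInd p ρ t) (LinearMap.congr_fun h2)⟩

/-- Shapiro's lemma for the Laurent representation. -/
noncomputable def laurentHomologyIso (hp : Function.Surjective p) (i : ℕ) :
    groupHomology (Rep.of (laurentRepresentation p ρ)) i ≅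
      characterHomology (ρ.comp p.ker.subtype) i := by
  classical
  exact (groupHomology.mapIso (MulEquiv.refl G)
    (LinearEquiv.ofBijective (indToLaurent p ρ).hom.toLinearMap (indToLaurent_bijective p ρ hp))
    (fun g ↦ (indToLaurent p ρ).hom.2 g) i).symm ≪≫ groupHomology.indIso p.ker _ i

end LaurentInduced

/-! ### Consequences of the long exact homology sequence -/

namespace groupHomology

variable {k G : Type} [Group G]

/-- Both the map into `H_i(X₃)` and the connecting map out of it vanish. In degree `0` right
exactness replaces the connecting map. -/
lemma subsingleton_of_shortExact [CommRing k] {X : ShortComplex (Rep k G)} (hX : X.ShortExact)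
    (i : ℕ) (hs : Function.Surjective (map (MonoidHom.id G) X.f i).hom)
    (hi : ∀ j, j + 1 = i → Function.Injective (map (MonoidHom.id G) X.f j).hom) :
    Subsingleton (groupHomology X.X₃ i) := by
  have hg (y : groupHomology X.X₂ i) : (map (MonoidHom.id G) X.g i).hom y = 0 := by
    obtain ⟨x, rfl⟩ := hs y
    exact congr(($((mapShortComplex₂ X i).zero)).hom x)
  refine subsingleton_of_forall_eq 0 fun z ↦ ?_
  cases i with
  | zero =>
    have := hX.epi_g
    obtain ⟨y, rfl⟩ := (ModuleCat.epi_iff_surjective _).1 (epi_map_0_of_epi X.g) z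
    exact hg y
  | succ j =>
    have h0 : (δ hX (j + 1) j rfl).hom z = 0 := by
      apply hi j rfl
      rw [map_zero]
      exact congr(($((mapShortComplex₁ hX (rfl : j + 1 = j + 1)).zero)).hom z)
    obtain ⟨y, rfl⟩ := (ShortComplex.moduleCat_exact_iff _).1
      (mapShortComplex₃_exact hX (rfl : j + 1 = j + 1)) z h0
    exact hg y

lemma finite_of_shortExact [Field k] {X : ShortComplex (Rep k G)} (hX : X.ShortExact)
    (i : ℕ) (h₂ : Module.Finite k (groupHomology X.X₂ i))
    (h₁ : ∀ j, j + 1 = i → Module.Finite k (groupHomology X.X₁ j)) :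
    Module.Finite k (groupHomology X.X₃ i) := by
  cases i with
  | zero =>
    have := hX.epi_g
    exact Module.Finite.of_surjective (map (MonoidHom.id G) X.g 0).hom
      ((ModuleCat.epi_iff_surjective _).1 (epi_map_0_of_epi X.g))
  | succ j =>
    have := h₁ j rfl
    have hker : LinearMap.ker (δ hX (j + 1) j rfl).hom ≤
        LinearMap.range (map (MonoidHom.id G) X.g (j + 1)).hom := fun z hz ↦
      (ShortComplex.moduleCat_exact_iff _).1
        (mapShortComplex₃_exact hX (rfl : j + 1 = j + 1)) z hz
    have : (LinearMap.ker (δ hX (j + 1) j rfl).hom).FG :=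
      Module.Finite.iff_fg.1 (Submodule.finiteDimensional_of_le hker)
    refine Module.finite_def.2 (Submodule.fg_of_fg_map_of_fg_inf_ker
      (δ hX (j + 1) j rfl).hom (IsNoetherian.noetherian _) ?_)
    simpa using this

end groupHomology

/-- All homology groups of `G` with coefficients in characters are finite-dimensional, and
in each degree only finitely many characters have nonzero homology. -/
structure HasTameCharacterHomology (G : Type) [Group G] : Prop where
  finite_homology (ρ : G →* ℂˣ) (i : ℕ) : Module.Finite ℂ (characterHomology ρ i)
  finite_nontrivial (i : ℕ) : {ρ : G →* ℂˣ | Nontrivial (characterHomology ρ i)}.Finite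

lemma mem_characteristicVariety_one {G : Type} [Group G] {i : ℕ} {ρ : G →* ℂˣ} :
    ρ ∈ characteristicVariety G i 1 ↔ Nontrivial (characterHomology ρ i) := by
  rw [characteristicVariety, Set.mem_ofPred_eq, Nat.cast_one, Cardinal.one_le_iff_pos,
    rank_pos_iff_nontrivial]

/-! ### Tameness and infinite cyclic quotients -/

namespace HasTameCharacterHomology

variable {G H : Type} [Group G] [Group H]

lemma of_mulEquiv (e : G ≃* H) (hG : HasTameCharacterHomology G) :
    HasTameCharacterHomology H := by
  have iso (ρ : H →* ℂˣ) (i : ℕ) : characterHomology (ρ.comp e.toMonoidHom) i ≅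
      characterHomology ρ i :=
    groupHomology.mapIso e (LinearEquiv.refl ℂ ℂ) (fun g ↦ rfl) i
  refine ⟨fun ρ i ↦ ?_, fun i ↦ ?_⟩
  · have := hG.finite_homology (ρ.comp e.toMonoidHom) i
    exact Module.Finite.equiv (iso ρ i).toLinearEquiv
  · refine ((hG.finite_nontrivial i).preimage (f := fun ρ ↦ ρ.comp e.toMonoidHom)
      fun ρ _ σ _ h ↦ ?_).subset fun ρ (hρ : Nontrivial _) ↦ ?_
    · exact (MonoidHom.cancel_right e.surjective).1 h
    · exact (iso ρ i).toLinearEquiv.toEquiv.nontrivial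

lemma of_subsingleton [Subsingleton G] : HasTameCharacterHomology G := by
  refine ⟨fun ρ i ↦ ?_, fun i ↦ ?_⟩
  · cases i with
    | zero =>
      exact Module.Finite.of_surjective (groupHomology.H0π _).hom
        ((ModuleCat.epi_iff_surjective _).1 inferInstance)
    | succ j =>
      have := ModuleCat.subsingleton_of_isZero
        (isZero_groupHomology_succ_of_subsingleton
          (Rep.of (characterRepresentation ρ)) j)
      infer_instance
  · have : Subsingleton (G →* ℂˣ) :=
      ⟨fun ρ σ ↦ MonoidHom.ext fun g ↦ by rw [Subsingleton.elim g 1, map_one, map_one]⟩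
    exact Set.toFinite _

section Laurent

variable (p : G →* Multiplicative ℤ)

lemma twistCharacter_one (ρ : G →* ℂˣ) : twistCharacter p ρ 1 = ρ := by
  ext g
  simp [twistCharacter_apply]

lemma exists_eq_twistCharacter (hp : Function.Surjective p) {ρ σ : G →* ℂˣ}
    (h : ρ.comp p.ker.subtype = σ.comp p.ker.subtype) : ∃ c, σ = twistCharacter p ρ c := by
  obtain ⟨t, ht⟩ := hp (Multiplicative.ofAdd 1)
  -- The characters agree on the kernel, so they differ only by their ratio at a lift `t` of the
  -- generator.
  refine ⟨(ρ t)⁻¹ * σ t, MonoidHom.ext fun g ↦ ?_⟩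
  have hk : g * t ^ (-(p g).toAdd) ∈ p.ker := by
    rw [MonoidHom.mem_ker]
    apply Multiplicative.toAdd.injective
    simp [ht]
  have := DFunLike.congr_fun h ⟨_, hk⟩
  simp only [MonoidHom.comp_apply, Subgroup.subtype_apply, zpow_neg, map_mul, map_inv, map_zpow] at this
  rw [twistCharacter_apply, mul_zpow, ← mul_assoc, inv_zpow, this, inv_mul_cancel_right]

lemma of_ker (hp : Function.Surjective p) (hker : HasTameCharacterHomology p.ker) :
    HasTameCharacterHomology G := by
  have hE (ρ : G →* ℂˣ) (i : ℕ) :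
      Module.Finite ℂ (groupHomology (Rep.of (laurentRepresentation p ρ)) i) :=
    have := hker.finite_homology (ρ.comp p.ker.subtype) i
    Module.Finite.equiv (laurentHomologyIso p ρ hp i).toLinearEquiv.symm
  let τ (ρ : G →* ℂˣ) (i : ℕ) := (groupHomology.map (A := Rep.of (laurentRepresentation p ρ))
    (B := Rep.of (laurentRepresentation p ρ)) (MonoidHom.id G) (laurentShift p ρ) i).hom
  -- For `i = 0` the truncated `i - 1` repeats degree `0`, which is harmless.
  have hsub (ρ : G →* ℂˣ) (c : ℂˣ) (i : ℕ)
      (h : Function.Bijective (1 - (c : ℂ) • τ ρ i : Module.End ℂ _))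
      (h' : Function.Bijective (1 - (c : ℂ) • τ ρ (i - 1) : Module.End ℂ _)) :
      Subsingleton (characterHomology (twistCharacter p ρ c) i) := by
    have hf (j : ℕ) (x : groupHomology (Rep.of (laurentRepresentation p ρ)) j) :
        (groupHomology.map (MonoidHom.id G) (laurentShortComplex p ρ c).f j).hom x =
          (1 - (c : ℂ) • τ ρ j : Module.End ℂ _) x :=
      LinearMap.congr_fun (groupHomology.map_one_sub_smul (c : ℂ) (laurentShift p ρ) j) x
    refine groupHomology.subsingleton_of_shortExact (laurentShortComplex_shortExact p ρ c) i
      (fun y ↦ (h.2 y).imp fun x hx ↦ (hf i x).trans hx) ?_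
    rintro j rfl x y hxy
    exact h'.1 ((hf j x).symm.trans (hxy.trans (hf j y)))
  refine ⟨fun ρ i ↦ ?_, fun i ↦ ?_⟩
  · have := groupHomology.finite_of_shortExact (laurentShortComplex_shortExact p ρ 1) i
      (hE ρ i) (fun j _ ↦ hE ρ j)
    rwa [show (laurentShortComplex p ρ 1).X₃ = Rep.of (characterRepresentation ρ) by
      conv_rhs => rw [← twistCharacter_one p ρ]
      rfl] at this
  · refine Set.Finite.of_finite_fibers (fun ρ : G →* ℂˣ ↦ ρ.comp p.ker.subtype)
      -- If the restriction has no homology in degrees `i` and `i - 1`, every endomorphism there is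
      -- bijective, and `c = 1` kills the homology of `ρ`.
      (((hker.finite_nontrivial i).union (hker.finite_nontrivial (i - 1))).subset ?_) ?_
    · rintro _ ⟨ρ, hρ : Nontrivial _, rfl⟩
      by_contra hnot
      simp only [Set.mem_union, Set.mem_ofPred_eq, not_or, not_nontrivial_iff_subsingleton] at hnot
      have h1 := fun j ↦ (laurentHomologyIso p ρ hp j).toLinearEquiv.toEquiv.subsingleton_congr
      have := (h1 i).2 hnot.1
      have := (h1 (i - 1)).2 hnot.2
      have hs := hsub ρ 1 i
        ⟨Function.injective_of_subsingleton _, Function.surjective_to_subsingleton _⟩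
        ⟨Function.injective_of_subsingleton _, Function.surjective_to_subsingleton _⟩
      rw [twistCharacter_one] at hs
      exact not_subsingleton _ hs
    · rintro _ ⟨ρ, -, rfl⟩
      have := hE ρ i
      have := hE ρ (i - 1)
      -- The fibre through `ρ` consists of twists of `ρ`, all governed by the same `τ ρ`.
      refine (((Module.End.finite_setOf_not_bijective_one_sub_smul (τ ρ i)).union
        (Module.End.finite_setOf_not_bijective_one_sub_smul (τ ρ (i - 1)))).image
          (twistCharacter p ρ)).subset ?_
      rintro σ ⟨hσ : Nontrivial _, hσρ⟩
      obtain ⟨c, rfl⟩ := exists_eq_twistCharacter p hp (Eq.symm hσρ)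
      refine ⟨c, ?_, rfl⟩
      by_contra hnot
      simp only [Set.mem_union, Set.mem_ofPred_eq, not_or, not_not] at hnot
      exact not_subsingleton _ (hsub ρ c i hnot.1 hnot.2)

end Laurent

end HasTameCharacterHomology

/-! ### Subgroups of finite index -/

lemma finite_setOf_comp_subtype_eq {G k : Type*} [Group G] [Field k] (S : Subgroup G)
    [S.FiniteIndex] (σ : S →* kˣ) : {ρ : G →* kˣ | ρ.comp S.subtype = σ}.Finite := by
  -- An extension of `σ` is determined by its values at coset representatives, each of which is a
  -- root of some `z ^ n = σ(s)`.
  have hpow (q : G ⧸ S) : ∃ n : ℕ, 0 < n ∧ q.out ^ n ∈ S := by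
    obtain ⟨n, hn, -, hS⟩ := Subgroup.exists_pow_mem_of_index_ne_zero
      (H := S) Subgroup.FiniteIndex.index_ne_zero q.out
    exact ⟨n, hn, hS⟩
  choose n hn hS using hpow
  have hroots (q : G ⧸ S) : {z : kˣ | z ^ n q = σ ⟨_, hS q⟩}.Finite := by
    classical
    refine ((Polynomial.nthRoots (n q) (σ ⟨_, hS q⟩ : k)).toFinset.finite_toSet.preimage
      (f := ((↑) : kˣ → k)) (fun a _ b _ h ↦ Units.ext h)).subset fun z (hz : _ = _) ↦ ?_
    simp [Polynomial.mem_nthRoots (hn q), ← hz]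
  refine Set.Finite.of_finite_image (f := fun ρ (q : G ⧸ S) ↦ ρ q.out)
    ((Set.Finite.pi hroots).subset ?_) ?_
  · rintro _ ⟨ρ, hρ, rfl⟩ q -
    rw [Set.mem_ofPred_eq, ← map_pow, ← show ρ.comp S.subtype = σ from hρ]
    rfl
  · intro ρ hρ τ hτ h
    ext1 g
    have hmem : (g : G ⧸ S).out⁻¹ * g ∈ S := QuotientGroup.leftRel_apply.1
      (Quotient.exact (QuotientGroup.out_eq' (g : G ⧸ S)))
    have h1 : ρ (g : G ⧸ S).out = τ (g : G ⧸ S).out := congr_fun h g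
    have h2 : ρ ((g : G ⧸ S).out⁻¹ * g) = τ ((g : G ⧸ S).out⁻¹ * g) :=
      DFunLike.congr_fun ((show ρ.comp S.subtype = σ from hρ).trans
        (show τ.comp S.subtype = σ from hτ).symm) (⟨_, hmem⟩ : S)
    simpa [h1] using h2

namespace Rep

variable {k G : Type} [Field k] [CharZero k] [Group G]

/-- Transfer: the unit into the coinduced module, identified with the induced one, followed by the
counit is a sum over cosets of `h⁻¹ h x = x`. This is multiplication by the index, invertible in
characteristic zero. -/
lemma exists_comp_indResHomEquiv_symm_id_eq_id (S : Subgroup G) [S.FiniteIndex]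
    (M : Rep.{0} k G) : ∃ u : M ⟶ ind S.subtype (res S.subtype M),
      u ≫ (indResHomEquiv S.subtype (res S.subtype M) M).symm (𝟙 _) = 𝟙 M := by
  classical
  let _ := Subgroup.fintypeQuotientOfFiniteIndex (H := S)
  let u := resCoindHomEquiv S.subtype M _ (𝟙 (res S.subtype M)) ≫
    (indCoindIso (res S.subtype M)).inv
  refine ⟨(S.index : k)⁻¹ • u, Rep.hom_ext (IntertwiningMap.ext (LinearMap.ext fun x ↦ ?_))⟩
  have hmk (h : G) (y : M) : ((indResHomEquiv S.subtype (res S.subtype M) M).symm (𝟙 _)).hom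
      (IndV.mk _ _ h y) = M.ρ h⁻¹ y := by
    simp
  change ((indResHomEquiv S.subtype (res S.subtype M) M).symm (𝟙 _)).hom
    ((S.index : k)⁻¹ • coindToInd (res S.subtype M) _) = x
  rw [map_smul, coindToInd_apply, map_sum, Finset.sum_eq_card_nsmul (b := x)]
  · have hcard : Nat.card (Quotient (QuotientGroup.rightRel S)) = S.index :=
      Nat.card_congr (QuotientGroup.quotientRightRelEquivQuotientLeftRel S)
    rw [Finset.card_univ, ← Nat.card_eq_fintype_card, hcard, ← Nat.cast_smul_eq_nsmul k,
      inv_smul_smul₀ (Nat.cast_ne_zero.2 Subgroup.FiniteIndex.index_ne_zero)]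
  · rintro q -
    induction q using Quotient.inductionOn with | h g =>
    refine (hmk g (M.ρ g x)).trans ?_
    simp

end Rep

namespace HasTameCharacterHomology

variable {G : Type} [Group G]

lemma of_finiteIndex (S : Subgroup G) [S.FiniteIndex] (hS : HasTameCharacterHomology S) :
    HasTameCharacterHomology G := by
  classical
  -- The split counit stays surjective on homology, and Shapiro identifies its source.
  have hsurj (ρ : G →* ℂˣ) (i : ℕ) :
      ∃ f : characterHomology (ρ.comp S.subtype) i →ₗ[ℂ] characterHomology ρ i,
        Function.Surjective f := by
    let M := Rep.of (characterRepresentation ρ)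
    obtain ⟨u, hu⟩ := Rep.exists_comp_indResHomEquiv_symm_id_eq_id S M
    have hu' := congr(groupHomology.map (A := M) (B := M) (MonoidHom.id G) $hu i)
    rw [groupHomology.map_id_comp, groupHomology.map_id] at hu'
    let e := (groupHomology.indIso S (Rep.res S.subtype M) i).toLinearEquiv
    have hc : Function.Surjective (groupHomology.map (MonoidHom.id G)
        ((Rep.indResHomEquiv S.subtype (Rep.res S.subtype M) M).symm (𝟙 _)) i).hom := fun z ↦
      ⟨(groupHomology.map (MonoidHom.id G) u i).hom z, congr(($hu').hom z)⟩
    exact ⟨_ ∘ₗ e.symm.toLinearMap, hc.comp e.symm.surjective⟩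
  refine ⟨fun ρ i ↦ ?_, fun i ↦ ?_⟩
  · obtain ⟨f, hf⟩ := hsurj ρ i
    have := hS.finite_homology (ρ.comp S.subtype) i
    exact Module.Finite.of_surjective f hf
  · refine Set.Finite.of_finite_fibers (fun ρ : G →* ℂˣ ↦ ρ.comp S.subtype)
      ((hS.finite_nontrivial i).subset ?_)
      fun σ _ ↦ (finite_setOf_comp_subtype_eq S σ).subset Set.inter_subset_right
    rintro _ ⟨ρ, hρ : Nontrivial _, rfl⟩
    obtain ⟨f, hf⟩ := hsurj ρ i
    exact hf.nontrivial

/-! ### Induction along the polycyclic series -/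

lemma of_isCyclic_quotient (N : Subgroup G) [N.Normal] [IsCyclic (G ⧸ N)]
    (hN : HasTameCharacterHomology N) : HasTameCharacterHomology G := by
  cases finite_or_infinite (G ⧸ N) with
  | inl h =>
    have : N.FiniteIndex := Subgroup.finiteIndex_of_finite_quotient
    exact of_finiteIndex N hN
  | inr h =>
    let e : G ⧸ N ≃* Multiplicative ℤ := intCyclicMulEquiv.symm
    refine of_ker (e.toMonoidHom.comp (QuotientGroup.mk' N))
      (e.surjective.comp (QuotientGroup.mk'_surjective N))
      (of_mulEquiv (MulEquiv.subgroupCongr ?_) hN)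
    ext g
    simp

lemma of_isPolycyclicGroup (hG : IsPolycyclicGroup G) : HasTameCharacterHomology G := by
  obtain ⟨n, H, h0, hn, hH⟩ := hG
  have key (k : ℕ) (hk : k ≤ n) : HasTameCharacterHomology (H k) := by
    induction k with
    | zero =>
      rw [h0]
      exact of_subsingleton
    | succ k ih =>
      obtain ⟨hle, hnormal, hcyclic⟩ := hH k hk
      exact of_isCyclic_quotient ((H k).subgroupOf (H (k + 1)))
        (of_mulEquiv (Subgroup.subgroupOfEquivOfLe hle).symm (ih (Nat.le_of_succ_le hk)))
  exact of_mulEquiv ((MulEquiv.subgroupCongr hn).trans Subgroup.topEquiv) (key n le_rfl)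

end HasTameCharacterHomology

theorem theorem3p5 (π : Type) [Group π] (hπ : IsVirtuallyPolycyclicGroup π) (i : ℕ) :
    (characteristicVariety π i 1).Finite := by
  obtain ⟨K, hK, hpoly⟩ := hπ
  refine ((HasTameCharacterHomology.of_finiteIndex K
    (.of_isPolycyclicGroup hpoly)).finite_nontrivial i).subset fun ρ hρ ↦ ?_
  exact mem_characteristicVariety_one.1 hρ
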